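/- **Farey triples.** For vertices $\frac pq,\frac ab\in\mathbb{Q}\cup\{\infty=\frac10\}$ of the Farey graph (in lowest terms, with nonnegative denominators) write $\frac pq\sim\frac ab$ if $|pb-qa|=1$. A Farey triple is a triple of pairwise adjacent rationals $\frac ab<\frac pq<\frac cd$ with $p=a+c$, $q=b+d$; $\frac pq$ is its center, and $\left(\frac ab,\frac cd\right)$ are the immediate precedents of $\frac pq$. Likewise $\frac 01,\frac 10$ are the immediate precedents of $\frac 11$. Let $\mathcal H$ be the set of horoballs of the maximal $\mathrm{PSL}(2,\mathbb{Z})$-invariant horoball packing of $\mathbb{H}^2$ with center in $\mathbb{Q}\cap[0,1]$; we identify a horoball with its center. **Labels.** The Markov labelling $\lambda_{\mathcal M}$ is $1$ at $\infty,0,-1$ and satisfies $\lambda_{\mathcal M}(H)=3xy-z$, where $x,y$ are the labels of the immediate precedents $H_1,H_2$ of $H$ and $z$ is the label of the other common Farey neighbor of $H_1$ and $H_2$. The fractional Markov labelling $\lambda_{\mathcal{FM}}$ is $\frac11$ at $\infty$ and $\frac01$ at $0$, and satisfies $$\lambda_{\mathcal{FM}}(H)=\frac{(k_1n_1+k_2n_2)/(k_2n_1-k_1n_2)}{3n_1n_2-(k_2n_1-k_1n_2)}$$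 when the immediate precedents $(H_1,H_2)$ of $H$ have labels $\frac{k_1}{n_1},\frac{k_2}{n_2}$ in lowest terms. For a Farey triple $H_1<H<H_2$ in $\mathcal H$ with Markov labels $m_1,m,m_2$, which satisfy $m_1^2+m^2+m_2^2=3m_1mm_2$, we say that $(m_1,m,m_2)$ is the ordered Markov triple at $(H_1,H,H_2)$. **Proposition.** Let $H_1<H<H_2$ be a Farey triple in $\mathcal H$, let $\frac{k_1}{n_1},\frac kn,\frac{k_2}{n_2}$ be the fractional Markov labels of $H_1,H,H_2$ in lowest terms with positive denominators, and let $L=\sqrt{9-\frac4{n^2}}$. The integral solutions $(a,c)$, $c\neq0$, of $$na^2-(3n+2k)ac+\left(3k+\frac{1+k^2}n\right)c^2=-n\qquad(\ast)$$ with $\frac kn\le\frac ac\le 3+\frac kn$ are, up to replacing $(a,c)$ by $(-a,-c)$, exactly the terms of two sequences $(a_i,c_i)_{i\ge1}$ and $(a_i',c_i')_{i\ge1}$ with $c_i,c_i'>0$ such that: 1. $3+\frac{k_1}{n_1}=\frac{a_1}{c_1}<\frac{a_2}{c_2}<\cdots$ converges to $\frac kn+\frac{3+L}2$. There are horoballs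 $H^{(1)}=H_1,H^{(2)},H^{(3)},\ldots$ in $\mathcal H$ such that for all $i\ge1$, $(c_i,c_{i+1},n)$ is the ordered Markov triple at $(H^{(i)},H^{(i+1)},H)$, and $\frac{a_i}{c_i}=3+\lambda_{\mathcal{FM}}(H^{(i)})$. 2. $\frac{k_2}{n_2}=\frac{a_1'}{c_1'}>\frac{a_2'}{c_2'}>\cdots$ converges to $\frac kn+\frac{3-L}2$. There are horoballs $H'^{(1)}=H_2,H'^{(2)},H'^{(3)},\ldots$ in $\mathcal H$ such that for all $i\ge1$, $(n,c_{i+1}',c_i')$ is the ordered Markov triple at $(H,H'^{(i+1)},H'^{(i)})$, and $\frac{a_i'}{c_i'}=\lambda_{\mathcal{FM}}(H'^{(i)})$. 3. Among the integral solutions of $(\ast)$ with $c\neq0$ and $\frac ac\ge\frac32+\frac kn$, the unique one up to sign that minimizes $\frac ac$ is $(a_1,c_1)=\left(3n_1+\frac{kn_1-n_2}n,\;n_1\right)$. -/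

import Mathlib

open Filter Topology

namespace FareyMarkov

/-! ### Vertices of the Farey graph: `ℚ ∪ {∞}`, with `∞ = 1/0` and `x = x.num / x.den` -/

/-- The numerator of a Farey vertex written in lowest terms with nonnegative denominator. -/
def vnum : OnePoint ℚ → ℤ
  | OnePoint.infty => 1
  | OnePoint.some x => x.num

/-- The denominator of a Farey vertex written in lowest terms; it is `0` exactly at `∞`. -/
def vden : OnePoint ℚ → ℤ
  | OnePoint.infty => 0
  | OnePoint.some x => x.den

/-- The Farey vertex `p/q` (with value `∞` when `q = 0`). -/
def vertex (p q : ℤ) : OnePoint ℚ :=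
  if q = 0 then OnePoint.infty else OnePoint.some ((p : ℚ) / (q : ℚ))

/-- Adjacency in the Farey graph: `p/q ∼ a/b` when `|p b - q a| = 1`. -/
def FareyAdj (v w : OnePoint ℚ) : Prop :=
  |vnum v * vden w - vden v * vnum w| = 1

/-- A Farey triple `u < v < w` of rationals with center `v`: pairwise adjacent, and `v` is the
mediant of `u` and `w`. Then `(u, w)` are the immediate precedents of `v`. -/
structure IsFareyTriple (u v w : ℚ) : Prop where
  lt_left : u < v
  lt_right : v < w
  adj_left : FareyAdj u v
  adj_right : FareyAdj v w
  adj_outer : FareyAdj u w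
  num_eq : v.num = u.num + w.num
  den_eq : v.den = u.den + w.den

/-! ### Immediate precedents of a positive rational

For `x = p/q > 0`, the immediate precedents are `a/b` and `(p-a)/(q-b)`, where
`p b - q a = 1` and `1 ≤ b ≤ q`. For `x = 1/1` they are `0/1` and `1/0`. -/

/-- The denominator `b` of the left immediate precedent: the inverse of `x.num` modulo `x.den`,
chosen in `{1, …, x.den}`. -/
def precDen (x : ℚ) : ℤ := (Int.gcdA x.num x.den - 1) % (x.den : ℤ) + 1

/-- The numerator `a` of the left immediate precedent, with `x.num * b - x.den * a = 1`. -/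
def precNum (x : ℚ) : ℤ := (x.num * precDen x - 1) / (x.den : ℤ)

/-- The left immediate precedent `H₁`. -/
def leftPrec (x : ℚ) : OnePoint ℚ := vertex (precNum x) (precDen x)

/-- The right immediate precedent `H₂`. -/
def rightPrec (x : ℚ) : OnePoint ℚ := vertex (x.num - precNum x) (x.den - precDen x)

/-- The vertex `K` opposite to `x` across the edge joining the immediate precedents `p₁/q₁` and
`p₂/q₂` of `x`, i.e. the other common neighbor `(p₂ - p₁)/(q₂ - q₁)` of these two vertices. -/
def oppVertex (x : ℚ) : OnePoint ℚ :=
  vertex (x.num - precNum x - precNum x) (x.den - precDen x - precDen x)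

/-- An auxiliary size, decreasing along the Farey order on nonnegative vertices. -/
def vsize (v : OnePoint ℚ) : ℕ := (vnum v + vden v).toNat

theorem prec_det (x : ℚ) : x.num * precDen x - x.den * precNum x = 1 := by
  have hg : (Int.gcd x.num x.den : ℤ) = 1 := by
    have := x.reduced
    rw [Int.gcd_eq_natAbs]
    simpa using this
  have hb := Int.gcd_eq_gcd_ab x.num x.den
  rw [hg] at hb
  have hmod := Int.emod_add_mul_ediv (Int.gcdA x.num x.den - 1) (x.den : ℤ)
  have hdvd : (x.den : ℤ) ∣ x.num * precDen x - 1 := by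
    refine ⟨-(Int.gcdB x.num x.den) - x.num * ((Int.gcdA x.num x.den - 1) / (x.den : ℤ)), ?_⟩
    unfold precDen
    linear_combination x.num * hmod - hb
  have := Int.mul_ediv_cancel' hdvd
  unfold precNum
  linarith

theorem one_le_precDen (x : ℚ) : 1 ≤ precDen x := by
  have hq : (0 : ℤ) < x.den := by exact_mod_cast x.den_pos
  have := Int.emod_nonneg (Int.gcdA x.num x.den - 1) hq.ne'
  unfold precDen
  linarith

theorem precDen_le (x : ℚ) : precDen x ≤ x.den := by
  have hq : (0 : ℤ) < x.den := by exact_mod_cast x.den_pos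
  have := Int.emod_lt_of_pos (Int.gcdA x.num x.den - 1) hq
  unfold precDen
  linarith

theorem precNum_nonneg {x : ℚ} (hx : 0 < x) : 0 ≤ precNum x := by
  have hq : (0 : ℤ) < x.den := by exact_mod_cast x.den_pos
  have hp : 0 < x.num := Rat.num_pos.mpr hx
  have h1 := prec_det x
  have h2 := one_le_precDen x
  by_contra h
  nlinarith

theorem precNum_lt {x : ℚ} (hx : 0 < x) : precNum x < x.num := by
  have hq : (0 : ℤ) < x.den := by exact_mod_cast x.den_pos
  have hp : 0 < x.num := Rat.num_pos.mpr hx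
  have h1 := prec_det x
  have h2 := precDen_le x
  by_contra h
  nlinarith

theorem vsize_vertex_lt {p q N : ℤ} (h : IsCoprime p q) (h1 : 1 < N) (h2 : p + q < N)
    (h3 : -(p + q) < N) : vsize (vertex p q) < N.toNat := by
  have key : ∀ a b : ℤ, 0 < b → IsCoprime a b → a + b < N →
      vsize (OnePoint.some ((a : ℚ) / (b : ℚ))) < N.toNat := by
    intro a b hb hab hlt
    have hc : Nat.Coprime a.natAbs b.natAbs := Int.isCoprime_iff_gcd_eq_one.mp hab
    have e1 := Rat.num_div_eq_of_coprime hb hc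
    have e2 := Rat.den_div_eq_of_coprime hb hc
    simp only [vsize, vnum, vden, e1, e2]
    omega
  unfold vertex
  split_ifs with hq
  · simp only [vsize, vnum, vden]
    omega
  · rcases lt_or_gt_of_ne hq with hlt | hgt
    · have := key (-p) (-q) (by omega) h.neg_neg (by omega)
      simpa [neg_div_neg_eq] using this
    · exact key p q hgt h h2

theorem vsize_leftPrec {x : ℚ} (hx : 0 < x) :
    vsize (leftPrec x) < vsize (OnePoint.some x) := by
  have h1 := prec_det x
  have h2 := one_le_precDen x
  have h3 := precDen_le x
  have h4 := precNum_nonneg hx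
  have h5 := precNum_lt hx
  refine vsize_vertex_lt ⟨-x.den, x.num, ?_⟩ ?_ ?_ ?_ <;> try simp only [vnum, vden]
  · linarith
  all_goals omega

theorem vsize_rightPrec {x : ℚ} (hx : 0 < x) :
    vsize (rightPrec x) < vsize (OnePoint.some x) := by
  have h1 := prec_det x
  have h2 := one_le_precDen x
  have h3 := precDen_le x
  have h4 := precNum_nonneg hx
  have h5 := precNum_lt hx
  refine vsize_vertex_lt ⟨x.den, -x.num, ?_⟩ ?_ ?_ ?_ <;> try simp only [vnum, vden]
  · linarith
  all_goals omega

theorem vsize_oppVertex {x : ℚ} (hx : 0 < x) :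
    vsize (oppVertex x) < vsize (OnePoint.some x) := by
  have h1 := prec_det x
  have h2 := one_le_precDen x
  have h3 := precDen_le x
  have h4 := precNum_nonneg hx
  have h5 := precNum_lt hx
  refine vsize_vertex_lt ⟨precDen x, -precNum x, ?_⟩ ?_ ?_ ?_ <;> try simp only [vnum, vden]
  · linarith
  all_goals omega

/-! ### The two labellings

The horoballs of `𝓗` are indexed by their centers, the rationals in `[0,1]`. -/

/-- The Markov labelling `λ_𝓜`: the label is `1` at the initial vertices `∞`, `0`, `-1`, and the
label of `x > 0` is `3 y z - t`, where `y`, `z` are the labels of the immediate precedents of `x`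
and `t` that of the vertex opposite to `x` across the edge joining them. (On starting from
`x > 0` the only nonpositive vertices ever reached are `0` and `-1`.) -/
def markovLabel : OnePoint ℚ → ℤ
  | OnePoint.infty => 1
  | OnePoint.some x =>
    if hx : 0 < x then
      have := vsize_leftPrec hx
      have := vsize_rightPrec hx
      have := vsize_oppVertex hx
      3 * markovLabel (leftPrec x) * markovLabel (rightPrec x) - markovLabel (oppVertex x)
    else 1
termination_by v => vsize v

/-- The value at a new vertex of the fractional Markov labelling, from the labels
`k₁/n₁` and `k₂/n₂` (in lowest terms) of its left and right immediate precedents: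
`((k₁ n₁ + k₂ n₂) / (k₂ n₁ - k₁ n₂)) / (3 n₁ n₂ - (k₂ n₁ - k₁ n₂))`. -/
def fracStep (y₁ y₂ : ℚ) : ℚ :=
  (((y₁.num * y₁.den + y₂.num * y₂.den : ℤ) : ℚ) /
      ((y₂.num * y₁.den - y₁.num * y₂.den : ℤ) : ℚ)) /
    ((3 * y₁.den * y₂.den - (y₂.num * y₁.den - y₁.num * y₂.den) : ℤ) : ℚ)

/-- The fractional Markov labelling `λ_𝓕𝓜`: the labels are `1/1` at `∞` and `0/1` at `0`, and the
label of `x > 0` is obtained by `fracStep` from those of its immediate precedents. (On starting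
from `x > 0` the only nonpositive vertex ever reached is `0`.) -/
def fracMarkovLabel : OnePoint ℚ → ℚ
  | OnePoint.infty => 1
  | OnePoint.some x =>
    if hx : 0 < x then
      have := vsize_leftPrec hx
      have := vsize_rightPrec hx
      fracStep (fracMarkovLabel (leftPrec x)) (fracMarkovLabel (rightPrec x))
    else 0
termination_by v => vsize v

/-- `(m₁, m, m₂)` is the ordered Markov triple at the horoballs of `𝓗` with centers
`H₁ < H < H₂`: the centers lie in `[0,1]` and form a Farey triple with center `H`, the Markov
labels are `m₁, m, m₂`, and these are positive and satisfy Markov's equation. -/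
structure IsOrderedMarkovTriple (H₁ H H₂ : ℚ) (m₁ m m₂ : ℤ) : Prop where
  nonneg : 0 ≤ H₁
  le_one : H₂ ≤ 1
  farey : IsFareyTriple H₁ H H₂
  label_left : markovLabel H₁ = m₁
  label_center : markovLabel H = m
  label_right : markovLabel H₂ = m₂
  pos_left : 0 < m₁
  pos_center : 0 < m
  pos_right : 0 < m₂
  markov : m₁ ^ 2 + m ^ 2 + m₂ ^ 2 = 3 * m₁ * m * m₂

/-- Markov's quadratic form equation
`n a² - (3n + 2k) a c + (3k + (1 + k²)/n) c² = -n` for the integers `a`, `c`. -/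
def IsMarkovFormSolution (k n a c : ℤ) : Prop :=
  (n : ℚ) * a ^ 2 - (3 * n + 2 * k) * a * c + (3 * k + (1 + k ^ 2) / n) * c ^ 2 = -n

end FareyMarkov

namespace FareyMarkov

/-! ### Unfolding the labellings -/

/-! Put `X = n a - k c`. Multiplied by `n`, the form equation becomes Markov's equation `X² + c² +
n² = 3 X c n`. Solutions with `c > 0` are thus Markov triples `(X, c, n)` of positive integers
satisfying `X ≡ -k c` mod `n`. The range condition then holds automatically, since `0 < X ≤ 3 n c`.

The Vieta moves that fix `n`, namely `(X, c) ↦ (3 n X - c, X)` and its inverse `(X, c) ↦ (c, 3 n c -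
X)`, preserve the congruence because `k² ≡ -1` mod `n`. Descent brings any solution to one with `X,
c ≤ n`. By `IsPosSolution.unique` this can only be `(n₁, n₂)`: fixing `k` as well as `n` makes the
uniqueness conjecture for Markov numbers unnecessary. So the solutions form a single orbit
(`IsPosSolution.induction`), whose two halves are the two sequences.

On the Farey side, the halves are the fans of mediants approaching `H` from the left and from the
right. Along each fan the labels follow the same Vieta recursion. This rests on the determinant
identities and `n l = k² + 1` collected in `LabelledTriple`, which pass to both children of a triple
and hold at `0 < 1/2 < 1`. The limits follow by solving the quadratic for `a / c` and letting `c →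
∞`. -/

theorem markovLabel_infty : markovLabel OnePoint.infty = 1 := by
  rw [markovLabel.eq_def]

theorem markovLabel_of_nonpos {x : ℚ} (hx : x ≤ 0) : markovLabel x = 1 := by
  rw [markovLabel.eq_def]
  exact dif_neg hx.not_gt

theorem markovLabel_of_pos {x : ℚ} (hx : 0 < x) :
    markovLabel x =
      3 * markovLabel (leftPrec x) * markovLabel (rightPrec x) - markovLabel (oppVertex x) := by
  rw [markovLabel.eq_def]
  exact dif_pos hx

theorem fracMarkovLabel_infty : fracMarkovLabel OnePoint.infty = 1 := by
  rw [fracMarkovLabel.eq_def]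

theorem fracMarkovLabel_zero : fracMarkovLabel (0 : ℚ) = 0 := by
  rw [fracMarkovLabel.eq_def]
  exact dif_neg (lt_irrefl _)

theorem fracMarkovLabel_of_pos {x : ℚ} (hx : 0 < x) :
    fracMarkovLabel x =
      fracStep (fracMarkovLabel (leftPrec x)) (fracMarkovLabel (rightPrec x)) := by
  rw [fracMarkovLabel.eq_def]
  exact dif_pos hx

/-! ### Farey triples and mediants -/

theorem vertex_eq_some {p q : ℤ} {x : ℚ} (hp : x.num = p) (hq : (x.den : ℤ) = q) :
    vertex p q = OnePoint.some x := by
  have hq0 : q ≠ 0 := by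
    rw [← hq]
    exact_mod_cast x.den_nz
  rw [vertex, if_neg hq0, ← hp, ← hq]
  simp [Rat.num_div_den]

theorem num_mul_den_lt {x y : ℚ} (h : x < y) : x.num * y.den < y.num * x.den :=
  Rat.lt_iff x y |>.mp h

theorem IsFareyTriple.det {u v w : ℚ} (h : IsFareyTriple u v w) :
    w.num * u.den - u.num * w.den = 1 := by
  have h1 := h.adj_outer
  have h2 := num_mul_den_lt (h.lt_left.trans h.lt_right)
  simp only [FareyAdj, vnum, vden] at h1
  rw [abs_of_nonpos (by linarith)] at h1
  linarith

theorem IsFareyTriple.of_det {u v w : ℚ} (hdet : w.num * u.den - u.num * w.den = 1)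
    (hnum : v.num = u.num + w.num) (hden : v.den = u.den + w.den) : IsFareyTriple u v w where
  lt_left := by
    rw [Rat.lt_iff, hnum, hden]
    push_cast
    linarith
  lt_right := by
    rw [Rat.lt_iff, hnum, hden]
    push_cast
    linarith
  adj_left := by
    simp only [FareyAdj, vnum, vden, hnum, hden]
    push_cast
    rw [show u.num * (u.den + w.den) - u.den * (u.num + w.num) = (-1 : ℤ) by linarith]
    rfl
  adj_right := by
    simp only [FareyAdj, vnum, vden, hnum, hden]
    push_cast
    rw [show (u.num + w.num) * w.den - (u.den + w.den) * w.num = (-1 : ℤ) by linarith]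
    rfl
  adj_outer := by
    simp only [FareyAdj, vnum, vden]
    rw [show u.num * w.den - u.den * w.num = (-1 : ℤ) by linarith]
    rfl
  num_eq := hnum
  den_eq := hden

/-- The mediant of two rationals. -/
def mediant (u w : ℚ) : ℚ := ((u.num + w.num : ℤ) : ℚ) / ((u.den + w.den : ℤ) : ℚ)

theorem exists_num_den {p q : ℤ} (hq : 0 < q) (h : IsCoprime p q) :
    ((p : ℚ) / q).num = p ∧ (((p : ℚ) / q).den : ℤ) = q :=
  have hc : Nat.Coprime p.natAbs q.natAbs := Int.isCoprime_iff_gcd_eq_one.mp h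
  ⟨Rat.num_div_eq_of_coprime hq hc, Rat.den_div_eq_of_coprime hq hc⟩

theorem isFareyTriple_mediant {u w : ℚ} (hdet : w.num * u.den - u.num * w.den = 1) :
    IsFareyTriple u (mediant u w) w := by
  have hu : (0 : ℤ) < u.den := by exact_mod_cast u.den_pos
  have hw : (0 : ℤ) < w.den := by exact_mod_cast w.den_pos
  obtain ⟨h1, h2⟩ := exists_num_den (p := u.num + w.num) (q := u.den + w.den) (by linarith)
    ⟨u.den, -u.num, by linarith⟩
  exact .of_det hdet h1 (Nat.cast_injective (R := ℤ) (h2.trans (Nat.cast_add _ _).symm))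

/-- The determinant equation fixes the denominator modulo `v.den`, and both candidates lie in `{1,
…, v.den}`. This links the computed precedents to the outer vertices of a Farey triple. -/
theorem IsFareyTriple.precDen_eq {u v w : ℚ} (h : IsFareyTriple u v w) :
    precDen v = u.den ∧ precNum v = u.num := by
  have hu : (0 : ℤ) < u.den := by exact_mod_cast u.den_pos
  have hw : (0 : ℤ) < w.den := by exact_mod_cast w.den_pos
  have hdet := h.det
  have hden : (v.den : ℤ) = u.den + w.den := by exact_mod_cast h.den_eq
  have h1 := prec_det v
  have h2 := one_le_precDen v
  have h3 := precDen_le v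
  have h4 : v.num * u.den - v.den * u.num = 1 := by
    rw [hden, h.num_eq]
    linarith
  have hcop : IsCoprime (v.den : ℤ) v.num := ⟨-u.num, u.den, by linarith⟩
  have hdvd : (v.den : ℤ) ∣ precDen v - u.den :=
    hcop.dvd_of_dvd_mul_left ⟨precNum v - u.num, by linear_combination h1 - h4⟩
  have hzero : precDen v - u.den = 0 :=
    Int.eq_zero_of_abs_lt_dvd hdvd (by rw [abs_lt]; constructor <;> linarith)
  have hb : precDen v = u.den := by linarith
  refine ⟨hb, ?_⟩
  rw [hb] at h1
  have hv : (v.den : ℤ) ≠ 0 := by linarith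
  exact mul_left_cancel₀ hv (by linarith)

theorem IsFareyTriple.leftPrec_eq {u v w : ℚ} (h : IsFareyTriple u v w) :
    leftPrec v = OnePoint.some u := by
  rw [leftPrec, h.precDen_eq.1, h.precDen_eq.2]
  exact vertex_eq_some rfl rfl

theorem IsFareyTriple.rightPrec_eq {u v w : ℚ} (h : IsFareyTriple u v w) :
    rightPrec v = OnePoint.some w := by
  have hden : (v.den : ℤ) = u.den + w.den := by exact_mod_cast h.den_eq
  rw [rightPrec, h.precDen_eq.1, h.precDen_eq.2]
  exact vertex_eq_some (by linarith [h.num_eq]) (by linarith)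

theorem IsFareyTriple.oppVertex_eq {u v w : ℚ} (h : IsFareyTriple u v w) :
    oppVertex v = vertex (w.num - u.num) (w.den - u.den) := by
  have hden : (v.den : ℤ) = u.den + w.den := by exact_mod_cast h.den_eq
  rw [oppVertex, h.precDen_eq.1, h.precDen_eq.2, h.num_eq, hden]
  congr 1 <;> ring

theorem IsFareyTriple.markovLabel_eq {u v w : ℚ} (h : IsFareyTriple u v w) (hu : 0 ≤ u) :
    markovLabel v = 3 * markovLabel u * markovLabel w -
      markovLabel (vertex (w.num - u.num) (w.den - u.den)) := by
  rw [markovLabel_of_pos (hu.trans_lt h.lt_left), h.leftPrec_eq, h.rightPrec_eq, h.oppVertex_eq]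

theorem IsFareyTriple.fracMarkovLabel_eq {u v w : ℚ} (h : IsFareyTriple u v w) (hu : 0 ≤ u) :
    fracMarkovLabel v = fracStep (fracMarkovLabel u) (fracMarkovLabel w) := by
  rw [fracMarkovLabel_of_pos (hu.trans_lt h.lt_left), h.leftPrec_eq, h.rightPrec_eq]

/-! ### Labels of Farey triples -/

/-- Farey triples in `[0,1]` together with their labels `k/n` and the integers
`l = (1 + k²)/n`, and the relations between these. -/
structure LabelledTriple (u v w : ℚ) (k₁ n₁ l₁ k n l k₂ n₂ l₂ : ℤ) : Prop where
  nonneg : 0 ≤ u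
  le_one : w ≤ 1
  farey : IsFareyTriple u v w
  markovLabel_left : markovLabel u = n₁
  markovLabel_center : markovLabel v = n
  markovLabel_right : markovLabel w = n₂
  frac_left : fracMarkovLabel u = (k₁ : ℚ) / n₁
  frac_center : fracMarkovLabel v = (k : ℚ) / n
  frac_right : fracMarkovLabel w = (k₂ : ℚ) / n₂
  pos_left : 0 < n₁
  pos_right : 0 < n₂
  two_mul_left_le : 2 * n₁ ≤ n
  two_mul_right_le : 2 * n₂ ≤ n
  root_left : n₁ * l₁ = k₁ ^ 2 + 1
  root_center : n * l = k ^ 2 + 1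
  root_right : n₂ * l₂ = k₂ ^ 2 + 1
  det_left : k * n₁ - k₁ * n = n₂
  det_right : k₂ * n - k * n₂ = n₁
  det_outer : k₂ * n₁ - k₁ * n₂ = 3 * n₁ * n₂ - n
  markov : n₁ ^ 2 + n ^ 2 + n₂ ^ 2 = 3 * n₁ * n * n₂

theorem isCoprime_of_root {k n l : ℤ} (h : n * l = k ^ 2 + 1) : IsCoprime k n :=
  ⟨-k, l, by linarith⟩

/-- `fracStep` in terms of integers. -/
theorem fracStep_eq {k₁ n₁ l₁ k n k₂ n₂ l₂ t : ℤ} (hn₁ : 0 < n₁) (hn₂ : 0 < n₂)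
    (h₁ : n₁ * l₁ = k₁ ^ 2 + 1) (h₂ : n₂ * l₂ = k₂ ^ 2 + 1) (ht : t ≠ 0)
    (hdet : k₂ * n₁ - k₁ * n₂ = t) (hn : n = 3 * n₁ * n₂ - t)
    (hk : k₁ * n₁ + k₂ * n₂ = k * t) :
    fracStep ((k₁ : ℚ) / n₁) ((k₂ : ℚ) / n₂) = (k : ℚ) / n := by
  obtain ⟨a1, b1⟩ := exists_num_den hn₁ (isCoprime_of_root h₁)
  obtain ⟨a2, b2⟩ := exists_num_den hn₂ (isCoprime_of_root h₂)
  have ht' : (t : ℚ) ≠ 0 := by exact_mod_cast ht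
  rw [fracStep, a1, a2, b1, b2, hdet, hk, hn]
  push_cast
  rw [mul_div_cancel_right₀ _ ht']

namespace LabelledTriple

variable {u v w : ℚ} {k₁ n₁ l₁ k n l k₂ n₂ l₂ : ℤ}

theorem pos_center (h : LabelledTriple u v w k₁ n₁ l₁ k n l k₂ n₂ l₂) : 0 < n := by
  linarith [h.pos_left, h.two_mul_left_le]

theorem isOrderedMarkovTriple (h : LabelledTriple u v w k₁ n₁ l₁ k n l k₂ n₂ l₂) :
    IsOrderedMarkovTriple u v w n₁ n n₂ :=
  ⟨h.nonneg, h.le_one, h.farey, h.markovLabel_left, h.markovLabel_center, h.markovLabel_right,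
    h.pos_left, h.pos_center, h.pos_right, h.markov⟩

/-- One linear recursion, `3 n₁ · (center) - (right)`, governs `k`, `n` and `l`. The vertex opposite
to the new center is `w`, and the divisor in `fracStep` is `n₂`, which divides its numerator exactly
by `hk`. -/
theorem left_child (h : LabelledTriple u v w k₁ n₁ l₁ k n l k₂ n₂ l₂) :
    LabelledTriple u (mediant u v) v k₁ n₁ l₁ (3 * k * n₁ - k₂) (3 * n * n₁ - n₂)
      (3 * l * n₁ - l₂) k n l := by
  have hn := h.pos_center
  have hden : (v.den : ℤ) = u.den + w.den := by exact_mod_cast h.farey.den_eq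
  have hF : IsFareyTriple u (mediant u v) v := isFareyTriple_mediant <| by
    rw [h.farey.num_eq, hden]
    linarith [h.farey.det]
  have hopp : vertex (v.num - u.num) (v.den - u.den) = w :=
    vertex_eq_some (by linarith [h.farey.num_eq]) (by linarith)
  -- Polarization of the form `n l - k²`. It is what keeps the value of that form equal to `1` at
  -- the new label.
  have hinner : n * l₂ + l * n₂ - 2 * k * k₂ = 3 * n₁ := by
    refine mul_left_cancel₀ (mul_ne_zero hn.ne' h.pos_right.ne') ?_
    have e : (k₂ * n - k * n₂) ^ 2 = n₁ ^ 2 := by rw [h.det_right]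
    linear_combination n ^ 2 * h.root_right + n₂ ^ 2 * h.root_center + e + h.markov
  have hk : k₁ * n₁ + k * n = (3 * k * n₁ - k₂) * n₂ := by
    linear_combination k * h.det_outer - k₂ * h.det_left - k₁ * h.det_right
  have hge : n ≤ n * n₁ := le_mul_of_one_le_right hn.le h.pos_left
  exact
    { nonneg := h.nonneg
      le_one := h.farey.lt_right.le.trans h.le_one
      farey := hF
      markovLabel_left := h.markovLabel_left
      markovLabel_center := by
        rw [hF.markovLabel_eq h.nonneg, hopp, h.markovLabel_left, h.markovLabel_center,
          h.markovLabel_right]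
        ring
      markovLabel_right := h.markovLabel_center
      frac_left := h.frac_left
      frac_center := by
        rw [hF.fracMarkovLabel_eq h.nonneg, h.frac_left, h.frac_center]
        exact fracStep_eq h.pos_left hn h.root_left h.root_center h.pos_right.ne' h.det_left
          (by ring) hk
      frac_right := h.frac_center
      pos_left := h.pos_left
      pos_right := hn
      two_mul_left_le := by linarith [h.two_mul_left_le, h.two_mul_right_le]
      two_mul_right_le := by linarith [h.two_mul_right_le]
      root_left := h.root_left
      root_center := by
        linear_combination 9 * n₁ ^ 2 * h.root_center - 3 * n₁ * hinner + h.root_right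
      root_right := h.root_center
      det_left := by linear_combination (-1) * h.det_outer + 3 * n₁ * h.det_left
      det_right := by linear_combination h.det_right
      det_outer := by linear_combination h.det_left
      markov := by linear_combination h.markov }

theorem right_child (h : LabelledTriple u v w k₁ n₁ l₁ k n l k₂ n₂ l₂) :
    LabelledTriple v (mediant v w) w k n l (3 * k * n₂ - k₁) (3 * n * n₂ - n₁)
      (3 * l * n₂ - l₁) k₂ n₂ l₂ := by
  have hn := h.pos_center
  have hden : (v.den : ℤ) = u.den + w.den := by exact_mod_cast h.farey.den_eq
  have hF : IsFareyTriple v (mediant v w) w := isFareyTriple_mediant <| by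
    rw [h.farey.num_eq, hden]
    linarith [h.farey.det]
  -- The difference is `u` with both numerator and denominator negated, so the signs must cancel.
  have hopp : vertex (w.num - v.num) (w.den - v.den) = u := by
    rw [h.farey.num_eq, hden, vertex]
    have hu : -(u.den : ℤ) ≠ 0 := by simp
    rw [show (w.den : ℤ) - (u.den + w.den) = -u.den by ring,
      show w.num - (u.num + w.num) = -u.num by ring, if_neg hu]
    push_cast
    rw [neg_div_neg_eq, Rat.num_div_den]
  have hinner : n₁ * l + l₁ * n - 2 * k₁ * k = 3 * n₂ := by
    refine mul_left_cancel₀ (mul_ne_zero hn.ne' h.pos_left.ne') ?_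
    have e : (k * n₁ - k₁ * n) ^ 2 = n₂ ^ 2 := by rw [h.det_left]
    linear_combination n₁ ^ 2 * h.root_center + n ^ 2 * h.root_left + e + h.markov
  have hk : k * n + k₂ * n₂ = (3 * k * n₂ - k₁) * n₁ := by
    linear_combination k * h.det_outer - k₂ * h.det_left - k₁ * h.det_right
  have hge : n ≤ n * n₂ := le_mul_of_one_le_right hn.le h.pos_right
  have hv : 0 ≤ v := h.nonneg.trans h.farey.lt_left.le
  exact
    { nonneg := hv
      le_one := h.le_one
      farey := hF
      markovLabel_left := h.markovLabel_center
      markovLabel_center := by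
        rw [hF.markovLabel_eq hv, hopp, h.markovLabel_left, h.markovLabel_center,
          h.markovLabel_right]
      markovLabel_right := h.markovLabel_right
      frac_left := h.frac_center
      frac_center := by
        rw [hF.fracMarkovLabel_eq hv, h.frac_center, h.frac_right]
        exact fracStep_eq hn h.pos_right h.root_center h.root_right h.pos_left.ne' h.det_right
          rfl hk
      frac_right := h.frac_right
      pos_left := hn
      pos_right := h.pos_right
      two_mul_left_le := by linarith [h.two_mul_left_le]
      two_mul_right_le := by linarith [h.two_mul_left_le, h.two_mul_right_le]
      root_left := h.root_center
      root_center := by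
        linear_combination 9 * n₂ ^ 2 * h.root_center - 3 * n₂ * hinner + h.root_left
      root_right := h.root_right
      det_left := by linear_combination h.det_left
      det_right := by linear_combination (-1) * h.det_outer + 3 * n₂ * h.det_right
      det_outer := by linear_combination h.det_right
      markov := by linear_combination h.markov }

end LabelledTriple

/-! ### The root triple and descent to it. -/

theorem IsFareyTriple.center_unique {u v v' w : ℚ} (h : IsFareyTriple u v w)
    (h' : IsFareyTriple u v' w) : v = v' :=
  Rat.ext (h.num_eq.trans h'.num_eq.symm) (h.den_eq.trans h'.den_eq.symm)

theorem prec_one : precDen 1 = 1 ∧ precNum 1 = 0 := by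
  have h1 := one_le_precDen 1
  have h2 := precDen_le 1
  have h3 := prec_det 1
  simp only [Rat.num_one, Rat.den_one, Nat.cast_one] at h2 h3
  constructor <;> linarith

theorem leftPrec_one : leftPrec 1 = (0 : ℚ) := by
  rw [leftPrec, prec_one.1, prec_one.2]
  exact vertex_eq_some rfl rfl

theorem rightPrec_one : rightPrec 1 = OnePoint.infty := by
  simp [rightPrec, prec_one, vertex]

theorem oppVertex_one : oppVertex 1 = (-1 : ℚ) := by
  rw [oppVertex, prec_one.1, prec_one.2, vertex, if_neg (by simp)]
  simp

theorem markovLabel_one : markovLabel (1 : ℚ) = 2 := by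
  rw [markovLabel_of_pos one_pos, leftPrec_one, rightPrec_one, oppVertex_one,
    markovLabel_infty, markovLabel_of_nonpos le_rfl, markovLabel_of_nonpos (by norm_num)]
  rfl

theorem fracMarkovLabel_one : fracMarkovLabel (1 : ℚ) = 1 / 2 := by
  rw [fracMarkovLabel_of_pos one_pos, leftPrec_one, rightPrec_one, fracMarkovLabel_zero,
    fracMarkovLabel_infty, fracStep]
  norm_num

theorem labelledTriple_root :
    LabelledTriple 0 (mediant 0 1) 1 0 1 1 2 5 1 1 2 1 := by
  have hF : IsFareyTriple 0 (mediant 0 1) 1 := isFareyTriple_mediant (by norm_num)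
  exact
    { nonneg := le_rfl
      le_one := le_rfl
      farey := hF
      markovLabel_left := markovLabel_of_nonpos le_rfl
      markovLabel_center := by
        rw [hF.markovLabel_eq le_rfl, markovLabel_one, markovLabel_of_nonpos le_rfl]
        simp [vertex, markovLabel_infty]
      markovLabel_right := markovLabel_one
      frac_left := by rw [fracMarkovLabel_zero]; norm_num
      frac_center := by
        rw [hF.fracMarkovLabel_eq le_rfl, fracMarkovLabel_one, fracMarkovLabel_zero]
        have := fracStep_eq (k₁ := 0) (n₁ := 1) (l₁ := 1) (k := 2) (n := 5) (k₂ := 1) (n₂ := 2)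
          (l₂ := 1) (t := 1) (by norm_num) (by norm_num) (by norm_num) (by norm_num) (by norm_num)
          (by norm_num) (by norm_num) (by norm_num)
        simpa using this
      frac_right := by rw [fracMarkovLabel_one]; norm_num
      pos_left := by norm_num
      pos_right := by norm_num
      two_mul_left_le := by norm_num
      two_mul_right_le := by norm_num
      root_left := by norm_num
      root_center := by norm_num
      root_right := by norm_num
      det_left := by norm_num
      det_right := by norm_num
      det_outer := by norm_num
      markov := by norm_num }

theorem num_le_den_of_le_one {x : ℚ} (h : x ≤ 1) : x.num ≤ x.den := by
  simpa using (Rat.le_iff x 1).mp h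

/-- Every Farey triple in `[0,1]` arises from `0 < 1/2 < 1` and hence carries labels. -/
theorem exists_labelledTriple {u v w : ℚ} (hu : 0 ≤ u) (hw : w ≤ 1) (h : IsFareyTriple u v w) :
    ∃ k₁ n₁ l₁ k n l k₂ n₂ l₂, LabelledTriple u v w k₁ n₁ l₁ k n l k₂ n₂ l₂ := by
  induction hN : v.den using Nat.strong_induction_on generalizing u v w with
  | _ N ih =>
  have hdet := h.det
  have hden := h.den_eq
  have hud : (0 : ℤ) < u.den := by exact_mod_cast u.den_pos
  have hwd : (0 : ℤ) < w.den := by exact_mod_cast w.den_pos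
  have hun : 0 ≤ u.num := Rat.num_nonneg.mpr hu
  have hwn := num_le_den_of_le_one hw
  -- Euclidean descent: the outer vertex with the larger denominator is the center of the parent
  -- triple. Equal denominators must be `1` by the determinant, which leaves only `0` and `1`.
  rcases lt_trichotomy (u.den : ℤ) w.den with hlt | heq | hgt
  · obtain ⟨h1, h2⟩ := exists_num_den (p := w.num - u.num) (q := w.den - u.den) (by linarith)
      ⟨u.den, -u.num, by linarith⟩
    set x : ℚ := ((w.num - u.num : ℤ) : ℚ) / ((w.den - u.den : ℤ) : ℚ)
    have hF : IsFareyTriple u w x := by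
      refine .of_det ?_ (by linarith) (by zify; linarith)
      rw [h1, h2]
      linarith
    have hx : x ≤ 1 := by
      rw [Rat.le_iff, h1, h2]
      simp only [Rat.num_one, Rat.den_one, Nat.cast_one, mul_one, one_mul]
      by_contra hcon
      nlinarith
    obtain ⟨k₁, n₁, l₁, k, n, l, k₂, n₂, l₂, hL⟩ :=
      ih w.den (by have := u.den_pos; omega) hu hx hF rfl
    have := hL.left_child
    rw [this.farey.center_unique h] at this
    exact ⟨_, _, _, _, _, _, _, _, _, this⟩
  · rw [heq, ← sub_mul] at hdet
    have hw1 : (w.den : ℤ) = 1 :=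
      Int.eq_one_of_dvd_one hwd.le (Dvd.intro_left _ hdet)
    have hw1' : w.den = 1 := by exact_mod_cast hw1
    have hu1' : u.den = 1 := by
      rw [hw1] at heq
      exact_mod_cast heq
    rw [hw1] at hdet hwn
    have hu0 : u = 0 := Rat.ext (by rw [Rat.num_zero]; linarith) hu1'
    have hw0 : w = 1 := Rat.ext (by rw [Rat.num_one]; linarith) hw1'
    subst hu0 hw0
    have := labelledTriple_root
    rw [this.farey.center_unique h] at this
    exact ⟨_, _, _, _, _, _, _, _, _, this⟩
  · obtain ⟨h1, h2⟩ := exists_num_den (p := u.num - w.num) (q := u.den - w.den) (by linarith)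
      ⟨-w.den, w.num, by linarith⟩
    set x : ℚ := ((u.num - w.num : ℤ) : ℚ) / ((u.den - w.den : ℤ) : ℚ)
    have hF : IsFareyTriple x u w := by
      refine .of_det ?_ (by linarith) (by zify; linarith)
      rw [h1, h2]
      linarith
    have hx : 0 ≤ x := by
      rw [← Rat.num_nonneg, h1]
      by_contra hcon
      nlinarith
    obtain ⟨k₁, n₁, l₁, k, n, l, k₂, n₂, l₂, hL⟩ :=
      ih u.den (by have := w.den_pos; omega) hx hw hF rfl
    have := hL.right_child
    rw [this.farey.center_unique h] at this
    exact ⟨_, _, _, _, _, _, _, _, _, this⟩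

/-! ### Markov's equation with one entry fixed -/

/-- The roots of `t² - 3 x y t + x² + y²` are `z` and `3 x y - z`. If both were at least `z`, the
polynomial would be nonnegative at `max x y`. This forces `x = y = 1`, where the roots are `1` and
`2`, against `z > 1`. -/
theorem vieta_lt {x y z : ℤ} (hx : 0 < x) (hy : 0 < y) (hxz : x ≤ z) (hyz : y ≤ z)
    (h : x ^ 2 + y ^ 2 + z ^ 2 = 3 * x * y * z) (h1 : 1 < z) :
    0 < 3 * x * y - z ∧ 3 * x * y - z < z := by
  have hz : 0 < z := hx.trans_le hxz
  have hprod : z * (3 * x * y - z) = x ^ 2 + y ^ 2 := by linarith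
  refine ⟨pos_of_mul_pos_right (a := z) (by rw [hprod]; positivity) hz.le, ?_⟩
  by_contra hcon
  have hle : z * z ≤ x ^ 2 + y ^ 2 := by
    rw [← hprod]
    exact mul_le_mul_of_nonneg_left (by linarith) hz.le
  rcases le_total x y with hxy | hxy
  · have a1 : 0 ≤ (z - y) * ((3 * x * y - z) - y) :=
      mul_nonneg (by linarith) (by linarith)
    have a2 : y ^ 2 ≤ x * y ^ 2 := le_mul_of_one_le_left (sq_nonneg y) hx
    have a3 : x ^ 2 ≤ y ^ 2 := by gcongr
    have a4 : x * y ^ 2 = y ^ 2 := by nlinarith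
    have a5 : x = 1 := mul_right_cancel₀ (b := y ^ 2) (by positivity) (by linarith)
    subst a5
    nlinarith
  · have a1 : 0 ≤ (z - x) * ((3 * x * y - z) - x) :=
      mul_nonneg (by linarith) (by linarith)
    have a2 : x ^ 2 ≤ y * x ^ 2 := le_mul_of_one_le_left (sq_nonneg x) hy
    have a3 : y ^ 2 ≤ x ^ 2 := by gcongr
    have a4 : y * x ^ 2 = x ^ 2 := by nlinarith
    have a5 : y = 1 := mul_right_cancel₀ (b := x ^ 2) (by positivity) (by linarith)
    subst a5
    nlinarith

/-- The entries of a Markov triple have no common prime factor. -/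
theorem not_dvd_markov {p : ℤ} (hp : 1 < p) {x y z : ℤ} (hx : 0 < x) (hy : 0 < y) (hz : 0 < z)
    (h : x ^ 2 + y ^ 2 + z ^ 2 = 3 * x * y * z) (hpx : p ∣ x) (hpy : p ∣ y) (hpz : p ∣ z) :
    False := by
  induction hN : (x + y + z).toNat using Nat.strong_induction_on generalizing x y z with
  | _ N ih =>
  have hx1 := Int.le_of_dvd hx hpx
  have hy1 := Int.le_of_dvd hy hpy
  have hz1 := Int.le_of_dvd hz hpz
  -- Vieta moves keep all entries divisible by `p > 1`, so the descent can never stop at `(1, 1,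
  -- 1)`.
  have hd {a b c : ℤ} (ha : p ∣ a) (hc : p ∣ c) : p ∣ 3 * a * b - c :=
    dvd_sub ((ha.mul_left 3).mul_right b) hc
  rcases le_total x y with hxy | hxy <;> rcases le_total y z with hyz | hyz <;>
    rcases le_total x z with hxz | hxz
  case inl.inl.inl | inr.inl.inl | inl.inl.inr =>
    obtain ⟨b1, b2⟩ := vieta_lt hx hy (by linarith) hyz h (by linarith)
    exact ih _ (by omega) hx hy b1 (by linear_combination h) hpx hpy (hd hpx hpz) rfl
  case inl.inr.inl | inl.inr.inr =>
    obtain ⟨b1, b2⟩ := vieta_lt (z := y) hx hz (by linarith) hyz (by linarith) (by linarith)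
    exact ih _ (by omega) hx b1 hz (by linear_combination h) hpx (hd hpx hpy) hpz rfl
  all_goals
    obtain ⟨b1, b2⟩ := vieta_lt (z := x) hy hz (by linarith) (by linarith) (by linarith)
      (by linarith)
    exact ih _ (by omega) b1 hy hz (by linear_combination h) (hd hpy hpx) hpy hpz rfl

/-- Solutions of `(∗)` with positive denominator, in terms of `X = n a - k c`. -/
structure IsPosSolution (k n a c : ℤ) : Prop where
  pos_den : 0 < c
  pos : 0 < n * a - k * c
  markov : (n * a - k * c) ^ 2 + c ^ 2 + n ^ 2 = 3 * (n * a - k * c) * c * n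

theorem IsPosSolution.isCoprime {k n a c : ℤ} (hn : 0 < n) (h : IsPosSolution k n a c) :
    IsCoprime c n := by
  rw [Int.isCoprime_iff_gcd_eq_one]
  by_contra hg
  have hg0 : Int.gcd c n ≠ 0 := by
    rw [Ne, Int.gcd_eq_zero_iff]
    exact fun hh => hn.ne' hh.2
  have hg1 : (1 : ℤ) < Int.gcd c n := by
    have : 1 < Int.gcd c n := by omega
    exact_mod_cast this
  have hdc : (Int.gcd c n : ℤ) ∣ c := Int.gcd_dvd_left ..
  have hdn : (Int.gcd c n : ℤ) ∣ n := Int.gcd_dvd_right ..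
  exact not_dvd_markov hg1 h.pos h.pos_den hn h.markov
    (dvd_sub (hdn.mul_right a) (hdc.mul_left k)) hdc hdn

/-- Dividing the equation by `n` shows that `n` divides `c` times this number, and `c` is prime to
`n`. Being linear in `(a, c)`, the congruence lets two solutions be compared. -/
theorem IsPosSolution.dvd {k n l a c : ℤ} (hn : 0 < n) (hl : n * l = k ^ 2 + 1)
    (h : IsPosSolution k n a c) : n ∣ (3 * k + l) * c - 2 * k * a := by
  refine (h.isCoprime hn).symm.dvd_of_dvd_mul_left (y := c) ⟨-(1 + a ^ 2 - 3 * a * c), ?_⟩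
  refine mul_left_cancel₀ hn.ne' ?_
  linear_combination h.markov + c ^ 2 * hl

/-- A solution with small entries is determined by `k` and `n`. -/
theorem IsPosSolution.unique {k n l a c a₀ c₀ : ℤ} (hn : 0 < n) (hl : n * l = k ^ 2 + 1)
    (h : IsPosSolution k n a c) (h₀ : IsPosSolution k n a₀ c₀)
    (hX : n * a - k * c ≤ n) (hc : c ≤ n)
    (hX₀ : 2 * (n * a₀ - k * c₀) ≤ n) (hc₀ : 2 * c₀ ≤ n) : a = a₀ ∧ c = c₀ := by
  -- Eliminating `3 k + l` between the two congruences leaves `2 k (a₀ c - a c₀)`. Below, the size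
  -- bounds put `2 (a₀ c - a c₀)` strictly between `-n` and `n`, so it vanishes.
  have hdvd : n ∣ 2 * (a₀ * c - a * c₀) := by
    refine (isCoprime_of_root hl).symm.dvd_of_dvd_mul_left (y := k) ?_
    obtain ⟨r, hr⟩ := h.dvd hn hl
    obtain ⟨s, hs⟩ := h₀.dvd hn hl
    exact ⟨c₀ * r - c * s, by linear_combination c₀ * hr - c * hs⟩
  have hD : n * (a₀ * c - a * c₀) = (n * a₀ - k * c₀) * c - (n * a - k * c) * c₀ := by ring
  have p1 := mul_pos h₀.pos h.pos_den
  have p2 := mul_pos h.pos h₀.pos_den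
  have b1 : 2 * ((n * a₀ - k * c₀) * c) ≤ n * n := by
    calc 2 * ((n * a₀ - k * c₀) * c) = (2 * (n * a₀ - k * c₀)) * c := by ring
      _ ≤ n * n := mul_le_mul hX₀ hc h.pos_den.le hn.le
  have b2 : 2 * ((n * a - k * c) * c₀) ≤ n * n := by
    calc 2 * ((n * a - k * c) * c₀) = (n * a - k * c) * (2 * c₀) := by ring
      _ ≤ n * n := mul_le_mul hX hc₀ (by linarith [h₀.pos_den]) hn.le
  have hzero : 2 * (a₀ * c - a * c₀) = 0 := by
    refine Int.eq_zero_of_abs_lt_dvd hdvd (abs_lt.mpr ⟨?_, ?_⟩)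
    · refine lt_of_mul_lt_mul_left (a := n) ?_ hn.le
      linarith
    · refine lt_of_mul_lt_mul_left (a := n) ?_ hn.le
      linarith
  have hcross : (n * a₀ - k * c₀) * c = (n * a - k * c) * c₀ := by
    have : a₀ * c - a * c₀ = 0 := by linarith
    rw [this] at hD
    linarith
  -- The pairs `(X, c)` and `(X₀, c₀)` are proportional, and the quadratic form `X² + c² - 3 n X c`
  -- takes the same value `-n²` on both.
  have hsq : c ^ 2 = c₀ ^ 2 := by
    refine mul_left_cancel₀ (pow_ne_zero 2 hn.ne') ?_
    linear_combination c ^ 2 * h₀.markov - c₀ ^ 2 * h.markov -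
      ((n * a₀ - k * c₀) * c + (n * a - k * c) * c₀ - 3 * n * c * c₀) * hcross
  have hcc : c = c₀ := (sq_eq_sq₀ h.pos_den.le h₀.pos_den.le).mp hsq
  refine ⟨?_, hcc⟩
  subst hcc
  have := mul_right_cancel₀ h.pos_den.ne' hcross
  exact mul_left_cancel₀ hn.ne' (by linarith)

/-- The Vieta move respects `X ≡ -k c` mod `n` because `k² ≡ -1`, so an integral `a'` exists. -/
theorem IsPosSolution.exists_shift {k n l a c : ℤ} (hl : n * l = k ^ 2 + 1)
    (h : IsPosSolution k n a c) (hpos : 0 < 3 * n * (n * a - k * c) - c) :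
    ∃ a', n * a' - k * (n * a - k * c) = 3 * n * (n * a - k * c) - c ∧
      IsPosSolution k n a' (n * a - k * c) := by
  have e : n * (3 * (n * a - k * c) + k * a - l * c) - k * (n * a - k * c) =
      3 * n * (n * a - k * c) - c := by linear_combination (-c) * hl
  refine ⟨_, e, h.pos, ?_, ?_⟩
  · rw [e]
    linarith
  · rw [e]
    linear_combination h.markov

theorem IsPosSolution.exists_unshift {k n l a c : ℤ} (hl : n * l = k ^ 2 + 1)
    (h : IsPosSolution k n a c) (hpos : 0 < 3 * n * c - (n * a - k * c)) :
    ∃ a', n * a' - k * (3 * n * c - (n * a - k * c)) = c ∧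
      IsPosSolution k n a' (3 * n * c - (n * a - k * c)) := by
  have e : n * (l * c - k * a + 3 * k * c) - k * (3 * n * c - (n * a - k * c)) = c := by
    linear_combination c * hl
  refine ⟨_, e, by linarith, ?_, ?_⟩
  · rw [e]
    exact h.pos_den
  · rw [e]
    linear_combination h.markov

/-- A set of pairs `(a, c)` that contains `(a₀, c₀)`, and with `(a, c)` also its two neighbors,
contains all solutions. -/
theorem IsPosSolution.induction {k n l a₀ c₀ : ℤ} (hn : 1 < n) (hl : n * l = k ^ 2 + 1)
    (h₀ : IsPosSolution k n a₀ c₀) (hX₀ : 2 * (n * a₀ - k * c₀) ≤ n) (hc₀ : 2 * c₀ ≤ n)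
    {P : ℤ → ℤ → Prop} (base : P (n * a₀ - k * c₀) c₀)
    (up : ∀ X c, P X c → P (3 * n * X - c) X)
    (down : ∀ X c, P X c → P c (3 * n * c - X))
    {a c : ℤ} (h : IsPosSolution k n a c) : P (n * a - k * c) c := by
  induction hN : (n * a - k * c + c).toNat using Nat.strong_induction_on generalizing a c with
  | _ N ih =>
  have hn0 : 0 < n := by linarith
  have hX := h.pos
  have hc := h.pos_den
  have hm := h.markov
  -- When the largest entry exceeds `n`, the Vieta move at that entry lowers `X + c`; the inverse
  -- move carries `P` back.
  have shift (hXc : n * a - k * c ≤ c) (hnc : n < c) : P (n * a - k * c) c := by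
    obtain ⟨b1, b2⟩ := vieta_lt hn0 hX hnc.le hXc (by linarith) (by linarith)
    obtain ⟨a', e, h'⟩ := h.exists_shift hl b1
    have := ih _ (by rw [e]; omega) h' rfl
    rw [e] at this
    simpa using down _ _ this
  have unshift (hXc : c ≤ n * a - k * c) (hnX : n < n * a - k * c) : P (n * a - k * c) c := by
    obtain ⟨b1, b2⟩ := vieta_lt hn0 hc hnX.le hXc (by linarith) (by linarith)
    obtain ⟨a', e, h'⟩ := h.exists_unshift hl b1
    have := ih _ (by rw [e]; omega) h' rfl
    rw [e] at this
    simpa using up _ _ this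
  rcases le_total (n * a - k * c) c with hXc | hXc
  · rcases le_or_gt c n with h2 | h2
    · obtain ⟨rfl, rfl⟩ := h.unique hn0 hl h₀ (hXc.trans h2) h2 hX₀ hc₀
      exact base
    · exact shift hXc h2
  · rcases le_or_gt (n * a - k * c) n with h1 | h1
    · obtain ⟨rfl, rfl⟩ := h.unique hn0 hl h₀ h1 (hXc.trans h1) hX₀ hc₀
      exact base
    · exact unshift hXc h1

/-! ### The two sequences -/

/-- The sequence with `x (i + 2) = 3 n x (i + 1) - x i`. -/
def vietaSeq (n x₀ x₁ : ℤ) : ℕ → ℤ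
  | 0 => x₀
  | 1 => x₁
  | i + 2 => 3 * vietaSeq n x₀ x₁ (i + 1) * n - vietaSeq n x₀ x₁ i

theorem LabelledTriple.left_ray {u v w : ℚ} {k₁ n₁ l₁ k n l k₂ n₂ l₂ : ℤ}
    (h : LabelledTriple u v w k₁ n₁ l₁ k n l k₂ n₂ l₂) (i : ℕ) :
    LabelledTriple ((mediant · v)^[i] u) ((mediant · v)^[i + 1] u) v
      (vietaSeq n k₁ (3 * k * n₁ - k₂) i) (vietaSeq n n₁ (3 * n * n₁ - n₂) i)
      (vietaSeq n l₁ (3 * l * n₁ - l₂) i)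
      (vietaSeq n k₁ (3 * k * n₁ - k₂) (i + 1)) (vietaSeq n n₁ (3 * n * n₁ - n₂) (i + 1))
      (vietaSeq n l₁ (3 * l * n₁ - l₂) (i + 1)) k n l := by
  induction i with
  | zero => exact h.left_child
  | succ i ih =>
    rw [Function.iterate_succ_apply' _ (i + 1)]
    exact ih.right_child

theorem LabelledTriple.right_ray {u v w : ℚ} {k₁ n₁ l₁ k n l k₂ n₂ l₂ : ℤ}
    (h : LabelledTriple u v w k₁ n₁ l₁ k n l k₂ n₂ l₂) (i : ℕ) :
    LabelledTriple v ((mediant v)^[i + 1] w) ((mediant v)^[i] w) k n l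
      (vietaSeq n k₂ (3 * k * n₂ - k₁) (i + 1)) (vietaSeq n n₂ (3 * n * n₂ - n₁) (i + 1))
      (vietaSeq n l₂ (3 * l * n₂ - l₁) (i + 1))
      (vietaSeq n k₂ (3 * k * n₂ - k₁) i) (vietaSeq n n₂ (3 * n * n₂ - n₁) i)
      (vietaSeq n l₂ (3 * l * n₂ - l₁) i) := by
  induction i with
  | zero => exact h.right_child
  | succ i ih =>
    rw [Function.iterate_succ_apply' _ (i + 1)]
    exact ih.left_child

/-- Here `3 n x i - x (i + 1)` is the term preceding `x i`, with `y` in position `-1`. The bound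
decides on which side of `3/2 + k/n` a solution lies. -/
theorem two_mul_prev_le {n x₀ y : ℤ} (hn : 0 < n) (hx₀ : 0 < x₀) (hy : 2 * y ≤ n)
    (hpos : ∀ i, 0 < vietaSeq n x₀ (3 * n * x₀ - y) i)
    (hdouble : ∀ i, 2 * vietaSeq n x₀ (3 * n * x₀ - y) i ≤ vietaSeq n x₀ (3 * n * x₀ - y) (i + 1))
    (i : ℕ) :
    2 * (3 * n * vietaSeq n x₀ (3 * n * x₀ - y) i - vietaSeq n x₀ (3 * n * x₀ - y) (i + 1)) ≤
      n * vietaSeq n x₀ (3 * n * x₀ - y) i := by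
  cases i with
  | zero =>
    have : n ≤ n * x₀ := le_mul_of_one_le_right hn.le hx₀
    simp only [vietaSeq]
    linarith
  | succ i =>
    have h1 := le_mul_of_one_le_left (hpos (i + 1)).le hn
    have h2 := hdouble i
    rw [vietaSeq]
    linarith

/-! ### Solutions of the form equation -/

theorem isMarkovFormSolution_iff {k n : ℤ} (hn : 0 < n) (a c : ℤ) :
    IsMarkovFormSolution k n a c ↔
      (n * a - k * c) ^ 2 + c ^ 2 + n ^ 2 = 3 * (n * a - k * c) * c * n := by
  have hn' : (n : ℚ) ≠ 0 := by exact_mod_cast hn.ne'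
  rw [IsMarkovFormSolution, ← @Int.cast_inj ℚ, ← mul_right_inj' hn']
  have e : (n : ℚ) * (n * a ^ 2 - (3 * n + 2 * k) * a * c + (3 * k + (1 + k ^ 2) / n) * c ^ 2) =
      n ^ 2 * a ^ 2 - n * (3 * n + 2 * k) * a * c + (3 * k * n + (1 + k ^ 2)) * c ^ 2 := by
    field_simp
  rw [e]
  push_cast
  constructor <;> intro h <;> linear_combination h

theorem IsMarkovFormSolution.neg {k n a c : ℤ} (h : IsMarkovFormSolution k n a c) :
    IsMarkovFormSolution k n (-a) (-c) := by
  simpa [IsMarkovFormSolution] using h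

theorem IsPosSolution.isMarkovFormSolution {k n a c : ℤ} (hn : 0 < n)
    (h : IsPosSolution k n a c) : IsMarkovFormSolution k n a c :=
  (isMarkovFormSolution_iff hn a c).mpr h.markov

theorem IsMarkovFormSolution.isPosSolution {k n a c : ℤ} (hn : 0 < n)
    (h : IsMarkovFormSolution k n a c) (hc : 0 < c) : IsPosSolution k n a c := by
  have hm := (isMarkovFormSolution_iff hn a c).mp h
  refine ⟨hc, ?_, hm⟩
  have : 0 < 3 * c * n * (n * a - k * c) := by
    calc 0 < (n * a - k * c) ^ 2 + c ^ 2 + n ^ 2 := by positivity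
      _ = _ := by rw [hm]; ring
  exact pos_of_mul_pos_right this (by positivity)

theorem IsMarkovFormSolution.isPosSolution_or {k n a c : ℤ} (hn : 0 < n)
    (h : IsMarkovFormSolution k n a c) (hc : c ≠ 0) :
    IsPosSolution k n a c ∨ IsPosSolution k n (-a) (-c) := by
  rcases hc.lt_or_gt with hc | hc
  · exact .inr (h.neg.isPosSolution hn (by linarith))
  · exact .inl (h.isPosSolution hn hc)

theorem div_eq_add {K : Type*} [Field K] [CharZero K] {k n a c : ℤ} (hn : 0 < n) (hc : 0 < c) :
    (a : K) / c = k / n + (n * a - k * c : ℤ) / (n * c) := by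
  have hn' : (n : K) ≠ 0 := by exact_mod_cast hn.ne'
  have hc' : (c : K) ≠ 0 := by exact_mod_cast hc.ne'
  push_cast
  field_simp
  ring

theorem IsPosSolution.mem_range {k n a c : ℤ} (hn : 0 < n) (h : IsPosSolution k n a c) :
    (k : ℚ) / n ≤ (a : ℚ) / c ∧ (a : ℚ) / c ≤ 3 + (k : ℚ) / n := by
  have hc := h.pos_den
  have hX := h.pos
  have hn' : (0 : ℚ) < n := by exact_mod_cast hn
  have hc' : (0 : ℚ) < c := by exact_mod_cast hc
  have hX' : (0 : ℚ) < (n * a - k * c : ℤ) := by exact_mod_cast hX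
  have hle : n * a - k * c ≤ 3 * (n * c) := by
    refine le_of_mul_le_mul_left (a := n * a - k * c) ?_ hX
    linarith [h.markov, sq_nonneg c, sq_nonneg n]
  have hle' : ((n * a - k * c : ℤ) : ℚ) ≤ 3 * (n * c) := by exact_mod_cast hle
  rw [div_eq_add (k := k) hn hc]
  constructor
  · linarith [div_pos hX' (mul_pos hn' hc')]
  · linarith [(div_le_iff₀ (mul_pos hn' hc')).mpr hle']

/-- Divided by `n² c²`, Markov's equation is a monic quadratic in `a / c - k / n` with discriminant
`9 - 4/n² - 4/c²`. -/
theorem IsPosSolution.abs_eq_sqrt {k n a c : ℤ} (hn : 0 < n) (h : IsPosSolution k n a c) :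
    |2 * ((a : ℝ) / c - k / n) - 3| = √(9 - 4 / (n : ℝ) ^ 2 - 4 / (c : ℝ) ^ 2) := by
  have hn' : (n : ℝ) ≠ 0 := by exact_mod_cast hn.ne'
  have hc' : (c : ℝ) ≠ 0 := by exact_mod_cast h.pos_den.ne'
  have hm : ((n : ℝ) * a - k * c) ^ 2 + c ^ 2 + n ^ 2 = 3 * (n * a - k * c) * c * n := by
    exact_mod_cast h.markov
  rw [← Real.sqrt_sq_eq_abs]
  congr 1
  field_simp
  linear_combination 4 * hm

theorem tendsto_sqrt {c : ℕ → ℤ} (hc : StrictMono c) (x : ℝ) :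
    Tendsto (fun i => √(x - 4 / (c i : ℝ) ^ 2)) atTop (𝓝 (√x)) := by
  have h1 : Tendsto (fun i => (c i : ℝ)) atTop atTop := by
    refine tendsto_intCast_atTop_atTop.comp ?_
    refine tendsto_atTop_mono (f := fun i : ℕ => c 0 + i) (fun i => ?_) ?_
    · induction i with
      | zero => simp
      | succ i ih =>
        have := hc (Nat.lt_succ_self i)
        push_cast at *
        linarith
    · exact tendsto_atTop_add_const_left _ _ tendsto_natCast_atTop_atTop
  have h2 : Tendsto (fun i => 4 / (c i : ℝ) ^ 2) atTop (𝓝 0) :=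
    ((tendsto_pow_atTop two_ne_zero).comp h1).const_div_atTop 4
  have h3 := (tendsto_const_nhds (x := x)).sub h2
  rw [sub_zero] at h3
  exact (Real.continuous_sqrt.tendsto x).comp h3

theorem div_lt_div_of_det {a c a' c' n : ℤ} (hn : 0 < n) (hc : 0 < c) (hc' : 0 < c')
    (h : n * (a' * c - a * c') = n ^ 2) : (a : ℚ) / c < (a' : ℚ) / c' := by
  have h1 : a' * c - a * c' = n := mul_left_cancel₀ hn.ne' (by linarith)
  rw [div_lt_div_iff₀ (by exact_mod_cast hc) (by exact_mod_cast hc')]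
  have h2 : a * c' < a' * c := by linarith
  exact_mod_cast h2

theorem eq_of_div_eq {k n k' n' : ℤ} (hn : 0 < n) (hn' : 0 < n') (hc : IsCoprime k n)
    (hc' : IsCoprime k' n') (h : (k : ℚ) / n = (k' : ℚ) / n') : k = k' ∧ n = n' := by
  obtain ⟨a1, b1⟩ := exists_num_den hn hc
  obtain ⟨a2, b2⟩ := exists_num_den hn' hc'
  exact ⟨by rw [← a1, h, a2], by rw [← b1, h, b2]⟩

end FareyMarkov

/-! ### Assembly: classification, monotonicity, limits and the minimal solution. -/

open FareyMarkov in
theorem mainTheorem10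
    -- `H` is a horoball with immediate precedents `H₁, H₂`, all three in `𝓗`
    (H₁ H H₂ : ℚ) (h_nonneg : 0 ≤ H₁) (h_le_one : H₂ ≤ 1)
    (h_farey : FareyMarkov.IsFareyTriple H₁ H H₂)
    -- the fractional Markov labels of `H₁, H, H₂` in lowest terms
    (k₁ n₁ k n k₂ n₂ : ℤ)
    (hn₁ : 0 < n₁) (hc₁ : IsCoprime k₁ n₁) (hl₁ : FareyMarkov.fracMarkovLabel H₁ = (k₁ : ℚ) / n₁)
    (hn : 0 < n) (hc : IsCoprime k n) (hl : FareyMarkov.fracMarkovLabel H = (k : ℚ) / n)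
    (hn₂ : 0 < n₂) (hc₂ : IsCoprime k₂ n₂) (hl₂ : FareyMarkov.fracMarkovLabel H₂ = (k₂ : ℚ) / n₂)
    (L : ℝ) (hL : L = Real.sqrt (9 - 4 / (n : ℝ) ^ 2)) :
    ∃ (a c a' c' : ℕ → ℤ) (G G' : ℕ → ℚ),
      (∀ i, 0 < c i) ∧ (∀ i, 0 < c' i) ∧
      -- the integral solutions in the given range are, up to sign, the terms of the two sequences
      (∀ x y : ℤ,
        (y ≠ 0 ∧ FareyMarkov.IsMarkovFormSolution k n x y ∧
          (k : ℚ) / n ≤ (x : ℚ) / y ∧ (x : ℚ) / y ≤ 3 + (k : ℚ) / n) ↔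
        (∃ i, (x = a i ∧ y = c i) ∨ (x = -a i ∧ y = -c i)) ∨
        (∃ i, (x = a' i ∧ y = c' i) ∨ (x = -a' i ∧ y = -c' i))) ∧
      -- the increasing sequence
      (a 0 : ℚ) / c 0 = 3 + (k₁ : ℚ) / n₁ ∧
      StrictMono (fun i => (a i : ℚ) / c i) ∧
      Tendsto (fun i => (a i : ℝ) / c i) atTop (𝓝 ((k : ℝ) / n + (3 + L) / 2)) ∧
      G 0 = H₁ ∧
      (∀ i, (a i : ℚ) / c i = 3 + FareyMarkov.fracMarkovLabel (G i)) ∧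
      (∀ i, FareyMarkov.IsOrderedMarkovTriple (G i) (G (i + 1)) H (c i) (c (i + 1)) n) ∧
      -- the decreasing sequence
      (a' 0 : ℚ) / c' 0 = (k₂ : ℚ) / n₂ ∧
      StrictAnti (fun i => (a' i : ℚ) / c' i) ∧
      Tendsto (fun i => (a' i : ℝ) / c' i) atTop (𝓝 ((k : ℝ) / n + (3 - L) / 2)) ∧
      G' 0 = H₂ ∧
      (∀ i, (a' i : ℚ) / c' i = FareyMarkov.fracMarkovLabel (G' i)) ∧
      (∀ i, FareyMarkov.IsOrderedMarkovTriple H (G' (i + 1)) (G' i) n (c' (i + 1)) (c' i)) ∧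
      -- the solution with the least ratio to the right of `3/2 + k/n`, unique up to sign
      (a 0 : ℚ) = 3 * n₁ + ((k : ℚ) * n₁ - n₂) / n ∧ c 0 = n₁ ∧
      (3 / 2 : ℚ) + (k : ℚ) / n ≤ (a 0 : ℚ) / c 0 ∧
      (∀ x y : ℤ, y ≠ 0 → FareyMarkov.IsMarkovFormSolution k n x y →
        (3 / 2 : ℚ) + (k : ℚ) / n ≤ (x : ℚ) / y →
        (a 0 : ℚ) / c 0 < (x : ℚ) / y ∨
          (x = a 0 ∧ y = c 0) ∨ (x = -a 0 ∧ y = -c 0)) := by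

  obtain ⟨κ₁, ν₁, l₁, κ, ν, l, κ₂, ν₂, l₂, hT⟩ := exists_labelledTriple h_nonneg h_le_one h_farey
  obtain ⟨rfl, rfl⟩ := eq_of_div_eq hT.pos_left hn₁ (isCoprime_of_root hT.root_left) hc₁
    (hT.frac_left.symm.trans hl₁)
  obtain ⟨rfl, rfl⟩ := eq_of_div_eq hT.pos_center hn (isCoprime_of_root hT.root_center) hc
    (hT.frac_center.symm.trans hl)
  obtain ⟨rfl, rfl⟩ := eq_of_div_eq hT.pos_right hn₂ (isCoprime_of_root hT.root_right) hc₂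
    (hT.frac_right.symm.trans hl₂)
  rename' κ₁ => k₁, ν₁ => n₁, κ => k, ν => n, κ₂ => k₂, ν₂ => n₂
  have hA := hT.left_ray
  have hB := hT.right_ray
  have hcA := two_mul_prev_le hn hn₁ hT.two_mul_right_le (fun i => (hA i).pos_left)
    (fun i => (hA i).two_mul_left_le)
  have hcB := two_mul_prev_le hn hn₂ hT.two_mul_left_le (fun i => (hB i).pos_right)
    (fun i => (hB i).two_mul_right_le)
  have hc0 : vietaSeq n n₁ (3 * n * n₁ - n₂) 0 = n₁ := rfl
  have hc1 : vietaSeq n n₁ (3 * n * n₁ - n₂) 1 = 3 * n * n₁ - n₂ := rfl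
  have hκ0 : vietaSeq n k₁ (3 * k * n₁ - k₂) 0 = k₁ := rfl
  have hc0' : vietaSeq n n₂ (3 * n * n₂ - n₁) 0 = n₂ := rfl
  have hc1' : vietaSeq n n₂ (3 * n * n₂ - n₁) 1 = 3 * n * n₂ - n₁ := rfl
  have hκ0' : vietaSeq n k₂ (3 * k * n₂ - k₁) 0 = k₂ := rfl
  have hrec : ∀ i, vietaSeq n n₁ (3 * n * n₁ - n₂) (i + 2) = 3 *
    vietaSeq n n₁ (3 * n * n₁ - n₂) (i + 1) * n - vietaSeq n n₁ (3 * n * n₁ - n₂) i := fun _ => rfl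
  have hrec' : ∀ i, vietaSeq n n₂ (3 * n * n₂ - n₁) (i + 2) = 3 *
    vietaSeq n n₂ (3 * n * n₂ - n₁) (i + 1) * n - vietaSeq n n₂ (3 * n * n₂ - n₁) i := fun _ => rfl
  set c := vietaSeq n n₁ (3 * n * n₁ - n₂)
  set c' := vietaSeq n n₂ (3 * n * n₂ - n₁)
  set κ := vietaSeq n k₁ (3 * k * n₁ - k₂)
  set κ' := vietaSeq n k₂ (3 * k * n₂ - k₁)
  -- The outer determinant gives `n κ i - k c i = c (i + 1) - 3 n c i`; adding `3` to the ratio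
  -- turns `X` into `c (i + 1)`. On the right side no shift is needed, since `X` is already the
  -- preceding term of `c'`.
  obtain ⟨a, ha⟩ : ∃ a : ℕ → ℤ, ∀ i, a i = κ i + 3 * c i := ⟨_, fun _ => rfl⟩
  have hpc : ∀ i, 0 < c i := fun i => (hA i).pos_left
  have hpc' : ∀ i, 0 < c' i := fun i => (hB i).pos_right
  have hcq : ∀ i, (c i : ℚ) ≠ 0 := fun i => by exact_mod_cast (hpc i).ne'
  have hnq : (0 : ℚ) < n := by exact_mod_cast hn
  have hX : ∀ i, n * a i - k * c i = c (i + 1) := fun i => by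
    rw [ha]
    linear_combination -(hA i).det_outer
  have hX' : ∀ i, n * κ' i - k * c' i = 3 * n * c' i - c' (i + 1) := fun i => by
    linear_combination (hB i).det_outer
  have hposB : ∀ i, 0 < 3 * n * c' i - c' (i + 1) := by
    rintro (_ | i)
    · rw [hc1', hc0']
      linarith
    · rw [hrec']
      linarith [hpc' i]
  have hS : ∀ i, IsPosSolution k n (a i) (c i) := fun i =>
    ⟨hpc i, by rw [hX]; exact hpc _, by rw [hX]; linear_combination (hA i).markov⟩
  have hS' : ∀ i, IsPosSolution k n (κ' i) (c' i) := fun i =>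
    ⟨hpc' i, by rw [hX']; exact hposB i, by rw [hX']; linear_combination (hB i).markov⟩
  have hclass : ∀ x y, IsPosSolution k n x y →
      (∃ i, x = a i ∧ y = c i) ∨ (∃ i, x = κ' i ∧ y = c' i) := by
    intro x y h
    -- The base solution is `(X, c) = (n₁, n₂)`, the start of the right sequence. Moving up from it
    -- gives `(c 1, c 0)`, where the two sequences join.
    have key := IsPosSolution.induction (P := fun X y => (∃ i, X = c (i + 1) ∧ y = c i) ∨
        ∃ i, X = 3 * n * c' i - c' (i + 1) ∧ y = c' i) (by linarith [hT.two_mul_left_le])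
      hT.root_center (hS' 0) (by rw [hX', hc0', hc1']; linarith [hT.two_mul_left_le])
      (by rw [hc0']; exact hT.two_mul_right_le) (.inr ⟨0, hX' 0, rfl⟩)
      (by
        rintro _ _ (⟨i, rfl, rfl⟩ | ⟨_ | i, rfl, rfl⟩)
        · exact .inl ⟨i + 1, by rw [hrec]; ring, rfl⟩
        · refine .inl ⟨0, ?_, ?_⟩
          · rw [hc0', hc1', hc1]; ring
          · rw [hc0', hc1', hc0]; ring
        · refine .inr ⟨i, ?_, ?_⟩
          · rw [hrec']; ring
          · rw [hrec']; ring)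
      (by
        rintro _ _ (⟨_ | i, rfl, rfl⟩ | ⟨i, rfl, rfl⟩)
        · refine .inr ⟨0, ?_, ?_⟩
          · rw [hc0', hc1']; ring
          · rw [hc0', hc1]; ring
        · exact .inl ⟨i, rfl, by rw [hrec]; ring⟩
        · refine .inr ⟨i + 1, ?_, ?_⟩
          · rw [hrec']; ring
          · ring) h
    rcases key with ⟨i, h1, rfl⟩ | ⟨i, h1, rfl⟩
    · rw [← hX] at h1
      exact .inl ⟨i, mul_left_cancel₀ hn.ne' (by linarith), rfl⟩
    · rw [← hX'] at h1
      exact .inr ⟨i, mul_left_cancel₀ hn.ne' (by linarith), rfl⟩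
  have hmono : StrictMono (fun i => (a i : ℚ) / c i) := strictMono_nat_of_lt_succ fun i => by
    refine div_lt_div_of_det hn (hpc _) (hpc _) ?_
    have e : n * (a (i + 1) * c i - a i * c (i + 1)) =
      (n * a (i + 1) - k * c (i + 1)) * c i - (n * a i - k * c i) * c (i + 1) := by ring
    rw [e, hX, hX, hrec]
    -- The determinant equals `c (i + 2) c i - c (i + 1)²`, which is `n²` by the recursion and
    -- Markov's equation.
    linear_combination -(hA i).markov
  have hanti : StrictAnti (fun i => (κ' i : ℚ) / c' i) := strictAnti_nat_of_succ_lt fun i => by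
    refine div_lt_div_of_det hn (hpc' _) (hpc' _) ?_
    have e : n * (κ' i * c' (i + 1) - κ' (i + 1) * c' i) =
      (n * κ' i - k * c' i) * c' (i + 1) - (n * κ' (i + 1) - k * c' (i + 1)) * c' i := by ring
    rw [e, hX', hX', hrec']
    linear_combination -(hB i).markov
  have hcmono : StrictMono c := strictMono_nat_of_lt_succ fun i => by
    linarith [hpc i, (hA i).two_mul_left_le]
  have hcmono' : StrictMono c' := strictMono_nat_of_lt_succ fun i => by
    linarith [hpc' i, (hB i).two_mul_right_le]
  have hge : ∀ i, (3 / 2 : ℚ) + (k : ℚ) / n ≤ (a i : ℚ) / c i := fun i => by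
    have hle : 3 * (n * c i) ≤ 2 * c (i + 1) := by linarith [hcA i, mul_pos hn (hpc i)]
    have hle' : (3 : ℚ) * (n * c i) ≤ 2 * c (i + 1) := by exact_mod_cast hle
    rw [div_eq_add (k := k) hn (hpc i), hX, add_comm]
    refine add_le_add le_rfl ?_
    rw [le_div_iff₀ (mul_pos hnq (by exact_mod_cast hpc i))]
    linarith
  have hlt : ∀ i, (κ' i : ℚ) / c' i < (3 / 2 : ℚ) + (k : ℚ) / n := fun i => by
    have hle : 2 * (3 * n * c' i - c' (i + 1)) < 3 * (n * c' i) := by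
      linarith [hcB i, mul_pos hn (hpc' i)]
    have hle' : 2 * ((3 * n * c' i - c' (i + 1) : ℤ) : ℚ) < 3 * (n * c' i) := by exact_mod_cast hle
    rw [div_eq_add (k := k) hn (hpc' i), hX', add_comm]
    refine add_lt_add_of_lt_of_le ?_ le_rfl
    rw [div_lt_iff₀ (mul_pos hnq (by exact_mod_cast hpc' i))]
    linarith
  have ha0 : (a 0 : ℚ) / c 0 = 3 + (k₁ : ℚ) / n₁ := by
    have hn₁' : (n₁ : ℚ) ≠ 0 := by exact_mod_cast hn₁.ne'
    rw [ha, hκ0, hc0]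
    push_cast
    field_simp
    ring
  refine ⟨a, c, κ', c', fun i => (mediant · H)^[i] H₁, fun i => (mediant H)^[i] H₂,
    hpc, hpc', ?_, ha0, hmono, ?_, rfl, ?_, fun i => (hA i).isOrderedMarkovTriple, ?_, hanti, ?_,
    rfl, fun i => (hB i).frac_right.symm, fun i => (hB i).isOrderedMarkovTriple, ?_, hc0, hge 0, ?_⟩
  · intro x y
    constructor
    · rintro ⟨hy, hsol, -, -⟩
      rcases hsol.isPosSolution_or hn hy with h | h
      · exact (hclass x y h).imp (fun ⟨i, hi⟩ => ⟨i, .inl hi⟩) (fun ⟨i, hi⟩ => ⟨i, .inl hi⟩)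
      · refine (hclass _ _ h).imp (fun ⟨i, h1, h2⟩ => ⟨i, .inr ?_⟩)
          (fun ⟨i, h1, h2⟩ => ⟨i, .inr ?_⟩) <;> constructor <;> linarith
    · have pos {x y : ℤ} (h : IsPosSolution k n x y) : y ≠ 0 ∧ IsMarkovFormSolution k n x y ∧
          (k : ℚ) / n ≤ (x : ℚ) / y ∧ (x : ℚ) / y ≤ 3 + (k : ℚ) / n :=
        ⟨h.pos_den.ne', h.isMarkovFormSolution hn, h.mem_range hn⟩
      have neg {x y : ℤ} (h : IsPosSolution k n x y) : -y ≠ 0 ∧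
          IsMarkovFormSolution k n (-x) (-y) ∧ (k : ℚ) / n ≤ ((-x : ℤ) : ℚ) / (-y : ℤ) ∧
          ((-x : ℤ) : ℚ) / (-y : ℤ) ≤ 3 + (k : ℚ) / n := by
        refine ⟨neg_ne_zero.mpr h.pos_den.ne', (h.isMarkovFormSolution hn).neg, ?_⟩
        push_cast
        rw [neg_div_neg_eq]
        exact h.mem_range hn
      rintro (⟨i, ⟨rfl, rfl⟩ | ⟨rfl, rfl⟩⟩ | ⟨i, ⟨rfl, rfl⟩ | ⟨rfl, rfl⟩⟩)
      exacts [pos (hS i), neg (hS i), pos (hS' i), neg (hS' i)]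
  · have lim := ((tendsto_sqrt hcmono (9 - 4 / (n : ℝ) ^ 2)).const_add 3).div_const 2
    rw [← hL] at lim
    refine (lim.const_add ((k : ℝ) / n)).congr fun i => ?_
    have h1 : (3 / 2 : ℝ) + (k : ℝ) / n ≤ (a i : ℝ) / c i := by
      have := (Rat.cast_le (K := ℝ)).mpr (hge i)
      push_cast at this
      exact this
    -- Lying to the right of `3/2 + k/n` selects the larger root of the quadratic.
    rw [← (hS i).abs_eq_sqrt hn, abs_of_nonneg (by linarith)]
    ring
  · intro i
    rw [(hA i).frac_left, ha]
    push_cast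
    field_simp [hcq i]
    ring
  · rw [hκ0', hc0']
  · have lim := ((tendsto_sqrt hcmono' (9 - 4 / (n : ℝ) ^ 2)).const_sub 3).div_const 2
    rw [← hL] at lim
    refine (lim.const_add ((k : ℝ) / n)).congr fun i => ?_
    have h1 : (κ' i : ℝ) / c' i < (3 / 2 : ℝ) + (k : ℝ) / n := by
      have := (Rat.cast_lt (K := ℝ)).mpr (hlt i)
      push_cast at this
      exact this
    rw [← (hS' i).abs_eq_sqrt hn, abs_of_neg (by linarith)]
    ring
  · have e : (k : ℚ) * n₁ - n₂ = k₁ * n := by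
      have := hT.det_left
      have : k * n₁ - n₂ = k₁ * n := by linarith
      exact_mod_cast this
    rw [e, mul_div_cancel_right₀ _ hnq.ne', ha, hκ0, hc0]
    push_cast
    ring
  · intro x y hy hsol hxy
    have key {x y : ℤ} (h : IsPosSolution k n x y) (hxy : (3 / 2 : ℚ) + (k : ℚ) / n ≤ (x : ℚ) / y) :
        (a 0 : ℚ) / c 0 < (x : ℚ) / y ∨ (x = a 0 ∧ y = c 0) := by
      rcases hclass x y h with ⟨_ | i, rfl, rfl⟩ | ⟨i, rfl, rfl⟩
      · exact .inr ⟨rfl, rfl⟩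
      · exact .inl (hmono (Nat.succ_pos i))
      · exact absurd hxy (hlt i).not_ge
    rcases hsol.isPosSolution_or hn hy with h | h
    · exact (key h hxy).imp_right .inl
    · have e : ((-x : ℤ) : ℚ) / (-y : ℤ) = (x : ℚ) / y := by
        push_cast
        rw [neg_div_neg_eq]
      have := key h (by rw [e]; exact hxy)
      rw [e] at this
      exact this.imp_right fun h => .inr ⟨by linarith, by linarith⟩
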